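/- All Hilbert spaces are complex, operators are bounded, $\mathcal R(\cdot)$ and $\mathcal N(\cdot)$ denote range and kernel, and $P_{\mathcal E}$ is the orthogonal projection onto a closed subspace $\mathcal E$. An operator $S$ is a quasi-isometry if $S^{*2}S^2=S^*S$, and left invertible if it is injective with closed range. If $\mathcal K$ contains $\mathcal H$ as a closed subspace, an operator $S$ on $\mathcal K$ is a lifting of $T$ on $\mathcal H$ if $PS=TP$, where $P:\mathcal K\to\mathcal H$ is the orthogonal projection. An operator $T$ is similar to $R$ if $XTX^{-1}=R$ for some bounded invertible $X$. When $\mathcal K=\mathcal L\oplus\mathcal M$ (orthogonal sum), subspaces of $\mathcal M$ are regarded as subspaces of $\mathcal K$. **Theorem 3.1.** Let $T$ be a bounded operator on a Hilbert space $\mathcal H$. (i) If $T$ is similar to a contraction, then there are a Hilbert space $\mathcal K\supset\mathcal H$, a quasi-isometric lifting $S$ of $T$ on $\mathcal K$ which is similar to an isometry, and a decomposition $\mathcal K=\mathcal L\oplus\mathcal M$ with $\{0\}\ne\mathcal L\subset\mathcal K\ominus\mathcal H$, under which $$S=\begin{pmatrix}V&G\\0&Q\end{pmatrix},$$ where $V=S|_{\mathcal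 L}$ is an isometry with $\mathcal N(V^*)=\mathcal R(G)$, and $Q$ is a quasi-isometric lifting of $T$ on $\mathcal M\supset\mathcal H$ with $\overline{\mathcal R(Q)}=\mathcal N(G)$ and $\mathcal N(Q^*)\subset\mathcal N(S^*)$. (ii) Let $S$ be any left invertible quasi-isometric lifting of $T$ on a Hilbert space $\mathcal K\supset\mathcal H$ which has the above block form with respect to a decomposition $\mathcal K=\mathcal L\oplus\mathcal M$, where $S\mathcal L\subset\mathcal L\subset\mathcal K\ominus\mathcal H$ and $V=S|_{\mathcal L}$ is an isometry with $\mathcal N(V^*)=\overline{\mathcal R(G)}$. Then $Q=P_{\mathcal M}S|_{\mathcal M}$ is a lifting of $T$ on $\mathcal M\supset\mathcal H$, and $Q$ is quasi-isometric if and only if $\mathcal R(Q)\subset\mathcal N(G)$. Moreover, the condition $$\mathcal R(G^*)\subset\mathcal N(Q^*)=\mathcal N(S^*)$$ holds if and only if $$S\mathcal R(Q)\subset\mathcal R(Q)\subset\mathcal R(S).$$ -/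

import Mathlib

open scoped InnerProductSpace
open ContinuousLinearMap (adjoint)

universe u v

namespace QuasiIsoLift

section Operators

variable {H : Type u} [NormedAddCommGroup H] [InnerProductSpace ℂ H]

/-- Two bounded operators on `H` are similar if they are conjugate by a bounded operator with
bounded inverse: `X A X⁻¹ = B`. -/
def Similar (A B : H →L[ℂ] H) : Prop :=
  ∃ X : H ≃L[ℂ] H, (X : H →L[ℂ] H) * A = B * (X : H →L[ℂ] H)

/-- `T` is similar to a contraction. See `similarToContraction_iff` for the form
`T* A T ≤ A` with `A` positive and invertible. -/
def SimilarToContraction (T : H →L[ℂ] H) : Prop :=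
  ∃ C : H →L[ℂ] H, ‖C‖ ≤ 1 ∧ Similar T C

/-- `T` is similar to an isometry. -/
def SimilarToIsometry (T : H →L[ℂ] H) : Prop :=
  ∃ U : H →L[ℂ] H, Isometry U ∧ Similar T U

/-- `T` is left invertible: injective with closed range. -/
def LeftInvertible (T : H →L[ℂ] H) : Prop :=
  Function.Injective T ∧ IsClosed (Set.range T)

/-- `T` is a quasi-isometry: `T*² T² = T* T`. -/
def QuasiIsometry [CompleteSpace H] (T : H →L[ℂ] H) : Prop :=
  adjoint T ^ 2 * T ^ 2 = adjoint T * T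

open scoped ComplexOrder in
theorem similarToContraction_iff [CompleteSpace H] (T : H →L[ℂ] H) :
    SimilarToContraction T ↔
      ∃ A : H →L[ℂ] H, 0 ≤ A ∧ IsUnit A ∧ adjoint T * A * T ≤ A := by
  constructor
  · rintro ⟨C, hC, X, hX⟩
    have hX' : ∀ x, X (T x) = C (X x) := fun x => by
      simpa using congrArg (fun F : H →L[ℂ] H => F x) hX
    refine ⟨adjoint (X : H →L[ℂ] H) * (X : H →L[ℂ] H), ?_, ?_, ?_⟩
    · exact star_mul_self_nonneg (X : H →L[ℂ] H)
    · have hu : IsUnit (X : H →L[ℂ] H) :=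
        ⟨⟨(X : H →L[ℂ] H), (X.symm : H →L[ℂ] H), by ext; simp, by ext; simp⟩, rfl⟩
      exact hu.star.mul hu
    · rw [ContinuousLinearMap.le_def, ContinuousLinearMap.isPositive_iff_complex]
      intro x
      have e : ⟪(adjoint (X : H →L[ℂ] H) * (X : H →L[ℂ] H)
          - adjoint T * (adjoint (X : H →L[ℂ] H) * (X : H →L[ℂ] H)) * T) x, x⟫_ℂ
          = ((‖X x‖ ^ 2 - ‖C (X x)‖ ^ 2 : ℝ) : ℂ) := by
        simp [ContinuousLinearMap.adjoint_inner_left, hX',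
          inner_self_eq_norm_sq_to_K]
      have h1 : ‖C (X x)‖ ≤ ‖X x‖ := by
        simpa using C.le_of_opNorm_le hC (X x)
      rw [e]
      refine ⟨rfl, ?_⟩
      have : ‖C (X x)‖ ^ 2 ≤ ‖X x‖ ^ 2 := by gcongr
      exact sub_nonneg.mpr this
  · rintro ⟨A, hA, hu, hle⟩
    set B := CFC.sqrt A with hB
    have hBB : B * B = A := CFC.sqrt_mul_sqrt_self A hA
    have hBs : adjoint B = B := (IsSelfAdjoint.of_nonneg (CFC.sqrt_nonneg A))
    have hBu : IsUnit B := by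
      rw [← hBB] at hu
      exact ((Commute.refl B).isUnit_mul_iff.mp hu).1
    obtain ⟨b, hb⟩ := hBu
    have n1 : ∀ x, ‖B x‖ ^ 2 = (⟪A x, x⟫_ℂ).re := fun x => by
      rw [← hBB, mul_apply_eq_comp, ← hBs, ContinuousLinearMap.adjoint_inner_left, hBs,
        inner_self_eq_norm_sq_to_K]
      norm_cast
    have n2 : ∀ x, ‖B (T x)‖ ≤ ‖B x‖ := fun x => by
      rw [ContinuousLinearMap.le_def, ContinuousLinearMap.isPositive_iff_complex] at hle
      have := (hle x).2
      simp [inner_sub_left, ContinuousLinearMap.adjoint_inner_left] at this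
      rw [← n1, ← n1] at this
      exact (sq_le_sq₀ (norm_nonneg _) (norm_nonneg _)).1 this
    refine ⟨B * T * (↑b⁻¹ : H →L[ℂ] H), ?_, ContinuousLinearEquiv.ofUnit b, ?_⟩
    · refine ContinuousLinearMap.opNorm_le_bound _ zero_le_one fun y => ?_
      have h := n2 ((↑b⁻¹ : H →L[ℂ] H) y)
      have h2 : B ((↑b⁻¹ : H →L[ℂ] H) y) = y := by
        rw [← hb, ← mul_apply_eq_comp, Units.mul_inv]; rfl
      rw [h2] at h
      simpa using h
    · have h3 : ((ContinuousLinearEquiv.ofUnit b : H ≃L[ℂ] H) : H →L[ℂ] H) = B := by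
        rw [← hb]; rfl
      rw [h3, mul_assoc, ← hb, Units.inv_mul, mul_one]

end Operators

section Liftings

variable {H : Type u} [NormedAddCommGroup H] [InnerProductSpace ℂ H]
variable {K : Type v} [NormedAddCommGroup K] [InnerProductSpace ℂ K]

/-- `S` on `K` is a lifting of `T` on `H`, where `H` is regarded as a closed subspace of `K`
through the isometric embedding `J`. The adjoint of `J` is the projection `P` of `K` onto `H`,
and the condition is `P S = T P`. -/
def IsLifting [CompleteSpace H] [CompleteSpace K] (J : H →ₗᵢ[ℂ] K) (S : K →L[ℂ] K)
    (T : H →L[ℂ] H) : Prop :=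
  adjoint J.toContinuousLinearMap ∘L S = T ∘L adjoint J.toContinuousLinearMap

/-- If `L ⊆ K ⊖ H`, then `H ⊆ M` for `M = K ⊖ L`: the embedding of `H` into `M`. -/
noncomputable def embedInto (J : H →ₗᵢ[ℂ] K) {L : Submodule ℂ K} (hL : L ≤ (LinearMap.range J.toLinearMap)ᗮ) :
    H →ₗᵢ[ℂ] Lᗮ where
  toLinearMap := J.toLinearMap.codRestrict Lᗮ
    (fun h => Submodule.orthogonal_le hL
      (Submodule.le_orthogonal_orthogonal _ (LinearMap.mem_range_self _ h)))
  norm_map' h := J.norm_map h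

/-- With respect to `K = L ⊕ M`, `M = K ⊖ L`, the operator `S` is the block matrix
`[[V, G], [0, Q]]`. -/
def HasBlockForm (S : K →L[ℂ] K) (L : Submodule ℂ K) (V : L →L[ℂ] L) (G : Lᗮ →L[ℂ] L)
    (Q : Lᗮ →L[ℂ] Lᗮ) : Prop :=
  ∀ (l : L) (m : Lᗮ), S ((l : K) + (m : K)) = ((V l + G m : L) : K) + ((Q m : Lᗮ) : K)

end Liftings

end QuasiIsoLift

/-! A lifting condition says that `H` is invariant under `adjoint S` with restriction `adjoint T`.

For (i), let `C` be the contraction similar to `T`, and let `U` on `R` be an isometric lifting of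
`C`. On `R ⊕ R` put `A (r, n) = (U r + F* n, 0)`. The range of `A` lies in the first summand, where
`A` acts as `U`, so `A` is a quasi-isometry for every `F`. The freedom in `F` is spent on making `A`
lift `T` itself: `H` is embedded by `h ↦ (a h, ι (b h))`, with `a` a small multiple of `ι Y T*` and
`b` its defect operator, and `F` is chosen injective with `F a = ι b T*`. Injectivity makes the
range of `A` dense in the first summand, the kernel of the second projection `B`
(`exists_quasiIsometric_lifting`). Adding a shift whose wandering subspace receives `B` makes the
operator bounded below (`exists_block_lifting`), and conjugation by its modulus then gives an
isometry (`similarToIsometry_of_quasiIsometry`).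

For (ii), orthogonality of `R(V)` and `R(G)` gives `‖G Q m‖² + ‖Q Q m‖² = ‖Q m‖²`, which settles the
quasi-isometry criterion. The range criterion rests on two facts: `adjoint S` agrees with `adjoint
Q` on `Lᗮ`, and both sides force `G Q = 0`. -/

namespace QuasiIsoLift

/-! ### Orthogonal sums and unilateral shifts. -/

/-- Two Hilbert spaces embed isometrically as complementary orthogonal subspaces of a third. -/
theorem exists_orthogonal_sum (A B : Type u) [NormedAddCommGroup A] [InnerProductSpace ℂ A]
    [CompleteSpace A] [NormedAddCommGroup B] [InnerProductSpace ℂ B] [CompleteSpace B] :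
    ∃ (K : Type u) (_ : NormedAddCommGroup K) (_ : InnerProductSpace ℂ K) (_ : CompleteSpace K)
      (i : A →ₗᵢ[ℂ] K) (j : B →ₗᵢ[ℂ] K),
      (∀ a b, ⟪i a, j b⟫_ℂ = 0) ∧ ∀ x, ∃ a b, x = i a + j b := by
  refine ⟨WithLp 2 (A × B), inferInstance, inferInstance, inferInstance,
    ⟨(WithLp.linearEquiv 2 ℂ (A × B)).symm.toLinearMap ∘ₗ LinearMap.inl ℂ A B, fun a => ?_⟩,
    ⟨(WithLp.linearEquiv 2 ℂ (A × B)).symm.toLinearMap ∘ₗ LinearMap.inr ℂ A B, fun b => ?_⟩,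
    fun a b => ?_, fun x => ⟨x.fst, x.snd, ?_⟩⟩
  · exact WithLp.norm_toLp_fst 2 A B a
  · exact WithLp.norm_toLp_snd 2 A B b
  · rw [WithLp.prod_inner_apply]
    change ⟪a, 0⟫_ℂ + ⟪0, b⟫_ℂ = 0
    rw [inner_zero_left, inner_zero_right, add_zero]
  · refine (WithLp.linearEquiv 2 ℂ (A × B)).injective (Prod.ext ?_ ?_)
    · exact (add_zero x.fst).symm
    · exact (zero_add x.snd).symm

theorem memℓp_two_cons {N : Type u} [NormedAddCommGroup N] (f : ℕ → N) :
    Memℓp f 2 ↔ Memℓp (fun k => f (k + 1)) 2 := by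
  rw [memℓp_gen_iff (by simp), memℓp_gen_iff (by simp)]
  exact (summable_nat_add_iff (f := fun k => ‖f k‖ ^ (2 : ENNReal).toReal) 1).symm

/-- A unilateral shift `σ` whose wandering subspace is a copy `δ` of a given Hilbert space. -/
theorem exists_shift (N : Type u) [NormedAddCommGroup N] [InnerProductSpace ℂ N]
    [CompleteSpace N] :
    ∃ (E : Type u) (_ : NormedAddCommGroup E) (_ : InnerProductSpace ℂ E) (_ : CompleteSpace E)
      (σ : E →ₗᵢ[ℂ] E) (δ : N →ₗᵢ[ℂ] E),
      (∀ x n, ⟪σ x, δ n⟫_ℂ = 0) ∧ ∀ x, ∃ y n, x = σ y + δ n := by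
  let c : (ℕ → N) → ℕ → N := fun f k => Nat.casesOn (motive := fun _ => N) k 0 f
  have hc : ∀ x : lp (fun _ : ℕ => N) 2, Memℓp (c x) 2 := fun x =>
    (memℓp_two_cons _).2 (lp.memℓp x)
  let s : lp (fun _ : ℕ => N) 2 →ₗ[ℂ] lp (fun _ : ℕ => N) 2 :=
    { toFun := fun x => ⟨c x, hc x⟩
      map_add' := fun x y => by
        ext k
        cases k
        · exact (add_zero (0 : N)).symm
        · rfl
      map_smul' := fun a x => by
        ext k
        cases k
        · exact (smul_zero a).symm
        · rfl }
  have s0 : ∀ x, s x 0 = 0 := fun _ => rfl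
  refine ⟨lp (fun _ : ℕ => N) 2, inferInstance, inferInstance, inferInstance, ⟨s, fun x => ?_⟩,
    ⟨lp.lsingle (𝕜 := ℂ) (E := fun _ : ℕ => N) 2 0, fun n => ?_⟩,
    fun x n => ?_, fun x => ⟨⟨fun k => x (k + 1), (memℓp_two_cons _).1 (lp.memℓp x)⟩, x 0, ?_⟩⟩
  · have h2 : 0 < (2 : ENNReal).toReal := by simp
    have h := lp.hasSum_norm h2 (s x)
    rw [← hasSum_nat_add_iff' 1] at h
    have h' := h.unique (lp.hasSum_norm h2 x)
    simp only [Finset.range_one, Finset.sum_singleton, s0, norm_zero] at h'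
    simpa using h'
  · exact lp.norm_single (E := fun _ : ℕ => N) (by simp) 0 n
  · exact (lp.inner_single_right (𝕜 := ℂ) (G := fun _ : ℕ => N) 0 n (s x)).trans (by rw [s0, inner_zero_left])
  · ext k
    cases k with
    | zero =>
      refine (zero_add (x 0)).symm.trans (congrArg (0 + ·) ?_)
      exact (lp.single_apply_self (E := fun _ : ℕ => N) 2 0 (x 0)).symm
    | succ k =>
      refine (add_zero (x (k + 1))).symm.trans (congrArg (x (k + 1) + ·) ?_)
      exact (lp.single_apply_ne (E := fun _ : ℕ => N) 2 0 (x 0) k.succ_ne_zero).symm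

/-! ### Quasi-isometries and defect operators. -/

section Operators

variable {H : Type u} [NormedAddCommGroup H] [InnerProductSpace ℂ H] [CompleteSpace H]

theorem quasiIsometry_iff_norm (S : H →L[ℂ] H) :
    QuasiIsometry S ↔ ∀ x, ‖S (S x)‖ ^ 2 = ‖S x‖ ^ 2 := by
  have key : ∀ x, ⟪(adjoint S ^ 2 * S ^ 2) x, x⟫_ℂ = ((‖S (S x)‖ ^ 2 : ℝ) : ℂ) := fun x => by
    simp [pow_two, ContinuousLinearMap.adjoint_inner_left, inner_self_eq_norm_sq_to_K]
  have key' : ∀ x, ⟪(adjoint S * S) x, x⟫_ℂ = ((‖S x‖ ^ 2 : ℝ) : ℂ) := fun x => by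
    simp [ContinuousLinearMap.adjoint_inner_left, inner_self_eq_norm_sq_to_K]
  constructor
  · intro h x
    have := key x
    rw [show adjoint S ^ 2 * S ^ 2 = adjoint S * S from h, key' x] at this
    exact_mod_cast this.symm
  · intro h
    refine ContinuousLinearMap.coe_injective ((ext_inner_map _ _).1 fun x => ?_)
    exact (key x).trans ((congrArg _ (h x)).trans (key' x).symm)

/-- A positive operator has a square root, invertible if the operator is. -/
theorem exists_norm_sq_eq_inner {A : H →L[ℂ] H} (hA : 0 ≤ A) :
    ∃ B : H →L[ℂ] H, (∀ x, ‖B x‖ ^ 2 = (⟪A x, x⟫_ℂ).re) ∧ (IsUnit A → IsUnit B) := by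
  have hBB : CFC.sqrt A * CFC.sqrt A = A := CFC.sqrt_mul_sqrt_self A hA
  have hBs : adjoint (CFC.sqrt A) = CFC.sqrt A := IsSelfAdjoint.of_nonneg (CFC.sqrt_nonneg A)
  refine ⟨CFC.sqrt A, fun x => ?_,
    fun hu => ((Commute.refl _).isUnit_mul_iff.mp (hBB.symm ▸ hu)).1⟩
  conv_rhs => rw [← hBB]
  rw [mul_apply_eq_comp, ← ContinuousLinearMap.adjoint_inner_right, hBs,
    inner_self_eq_norm_sq_to_K]
  norm_cast

open scoped ComplexOrder in
/-- A contraction has a defect operator, invertible if the contraction is strict. -/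
theorem exists_defect {K : Type v} [NormedAddCommGroup K] [InnerProductSpace ℂ K]
    [CompleteSpace K] {C : H →L[ℂ] K} (hC : ‖C‖ ≤ 1) :
    ∃ D : H →L[ℂ] H, (∀ x, ‖C x‖ ^ 2 + ‖D x‖ ^ 2 = ‖x‖ ^ 2) ∧ (‖C‖ < 1 → IsUnit D) := by
  have key : ∀ x, ⟪(1 - adjoint C ∘L C) x, x⟫_ℂ = ((‖x‖ ^ 2 - ‖C x‖ ^ 2 : ℝ) : ℂ) := fun x => by
    simp [ContinuousLinearMap.adjoint_inner_left, inner_self_eq_norm_sq_to_K]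
  have hpos : 0 ≤ 1 - adjoint C ∘L C := by
    rw [ContinuousLinearMap.nonneg_iff_isPositive, ContinuousLinearMap.isPositive_iff_complex]
    intro x
    rw [key]
    refine ⟨rfl, ?_⟩
    have h1 : ‖C x‖ ≤ ‖x‖ := by simpa using C.le_of_opNorm_le hC x
    have : ‖C x‖ ^ 2 ≤ ‖x‖ ^ 2 := by gcongr
    exact sub_nonneg.mpr this
  obtain ⟨D, hD, hu⟩ := exists_norm_sq_eq_inner hpos
  refine ⟨D, fun x => ?_, fun h => hu (isUnit_one_sub_of_norm_lt_one ?_)⟩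
  · rw [hD, key, Complex.ofReal_re]
    ring
  · rw [ContinuousLinearMap.norm_adjoint_comp_self]
    nlinarith [norm_nonneg C]

/-- The modulus `B` of `S` satisfies `‖B x‖ = ‖S x‖` and is invertible by the lower bound. Since `‖B
S x‖ = ‖S S x‖ = ‖S x‖ = ‖B x‖`, the conjugate `B S B⁻¹` is isometric. -/
theorem similarToIsometry_of_quasiIsometry {S : H →L[ℂ] H} (hS : QuasiIsometry S) {c : ℝ}
    (hc : 0 < c) (hb : ∀ x, c * ‖x‖ ^ 2 ≤ ‖S x‖ ^ 2) : SimilarToIsometry S := by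
  have key : ∀ x, ⟪(adjoint S * S) x, x⟫_ℂ = ((‖S x‖ ^ 2 : ℝ) : ℂ) := fun x => by
    simp [ContinuousLinearMap.adjoint_inner_left, inner_self_eq_norm_sq_to_K]
  have hu : IsUnit (adjoint S * S) := by
    refine ContinuousLinearMap.isUnit_of_forall_le_norm_inner_map _ (c := ⟨c, hc.le⟩) hc
      fun x => ?_
    rw [key, Complex.norm_real, Real.norm_of_nonneg (by positivity), mul_comm]
    exact hb x
  obtain ⟨B, hB, hBu⟩ := exists_norm_sq_eq_inner (star_mul_self_nonneg S)
  obtain ⟨b, rfl⟩ := hBu hu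
  have hn : ∀ x, ‖(b : H →L[ℂ] H) x‖ ^ 2 = ‖S x‖ ^ 2 := fun x => by
    rw [hB]
    exact congrArg Complex.re (key x)
  refine ⟨b * S * (↑b⁻¹ : H →L[ℂ] H), ?_, ContinuousLinearEquiv.ofUnit b, ?_⟩
  · refine AddMonoidHomClass.isometry_of_norm _ fun y => ?_
    have h2 : (b : H →L[ℂ] H) ((↑b⁻¹ : H →L[ℂ] H) y) = y := by
      rw [← mul_apply_eq_comp, Units.mul_inv]; rfl
    have h := hn (S ((↑b⁻¹ : H →L[ℂ] H) y))
    rw [(quasiIsometry_iff_norm S).1 hS, ← hn, h2] at h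
    exact (sq_eq_sq₀ (norm_nonneg _) (norm_nonneg _)).1 h
  · have h3 : ((ContinuousLinearEquiv.ofUnit b : H ≃L[ℂ] H) : H →L[ℂ] H) = b := rfl
    rw [h3, mul_assoc, Units.inv_mul, mul_one]

end Operators

/-! ### Upper triangular block operators. -/

section BlockForm

variable {K : Type v} [NormedAddCommGroup K] [InnerProductSpace ℂ K]
variable {S : K →L[ℂ] K} {L : Submodule ℂ K} {V : L →L[ℂ] L} {G : Lᗮ →L[ℂ] L}
  {Q : Lᗮ →L[ℂ] Lᗮ}

theorem HasBlockForm.apply_left (h : HasBlockForm S L V G Q) (l : L) : S l = (V l : L) := by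
  simpa using h l 0

theorem HasBlockForm.apply_right (h : HasBlockForm S L V G Q) (m : Lᗮ) :
    S m = (G m : L) + (Q m : Lᗮ) := by
  simpa using h 0 m

theorem HasBlockForm.norm_sq_apply_right (h : HasBlockForm S L V G Q) (m : Lᗮ) :
    ‖S m‖ ^ 2 = ‖G m‖ ^ 2 + ‖Q m‖ ^ 2 := by
  have := norm_add_sq_eq_norm_sq_add_norm_sq_of_inner_eq_zero (𝕜 := ℂ) ((G m : L) : K)
    ((Q m : Lᗮ) : K) ((Q m).2 _ (G m).2)
  rw [h.apply_right]
  simpa [pow_two] using this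

/-- An operator leaving a complete subspace invariant is block upper triangular. -/
theorem exists_hasBlockForm [CompleteSpace L] (h : ∀ l ∈ L, S l ∈ L) :
    ∃ V G Q, HasBlockForm S L V G Q := by
  refine ⟨L.orthogonalProjectionOnto ∘L S ∘L L.subtypeL,
    L.orthogonalProjectionOnto ∘L S ∘L Lᗮ.subtypeL,
    Lᗮ.orthogonalProjectionOnto ∘L S ∘L Lᗮ.subtypeL, fun l m => ?_⟩
  have h1 : (L.orthogonalProjectionOnto (S l) : K) = S l :=
    Submodule.starProjection_eq_self_iff.2 (h _ l.2)
  have h2 : (L.orthogonalProjectionOnto (S m) : K) + (Lᗮ.orthogonalProjectionOnto (S m) : K) =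
    S m := Submodule.starProjection_add_starProjection_orthogonal _
  change S (l + m) = ((L.orthogonalProjectionOnto (S l) : K) + L.orthogonalProjectionOnto (S m)) +
    Lᗮ.orthogonalProjectionOnto (S m)
  rw [map_add, h1, add_assoc, h2]

end BlockForm

/-! ### Liftings in block form, and the criteria of (ii). -/

section Liftings

variable {H : Type u} [NormedAddCommGroup H] [InnerProductSpace ℂ H] [CompleteSpace H]
variable {K : Type v} [NormedAddCommGroup K] [InnerProductSpace ℂ K] [CompleteSpace K]

/-- This is the adjoint form `S* J = J T*`, tested against vectors so that it can be checked one
summand at a time. -/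
theorem isLifting_iff_inner (J : H →ₗᵢ[ℂ] K) (S : K →L[ℂ] K) (T : H →L[ℂ] H) :
    IsLifting J S T ↔ ∀ x h, ⟪S x, J h⟫_ℂ = ⟪x, J (adjoint T h)⟫_ℂ := by
  have e1 : ∀ x h, ⟪(adjoint J.toContinuousLinearMap ∘L S) x, h⟫_ℂ = ⟪S x, J h⟫_ℂ :=
    fun x h => by simp [ContinuousLinearMap.adjoint_inner_left]
  have e2 : ∀ x h, ⟪(T ∘L adjoint J.toContinuousLinearMap) x, h⟫_ℂ = ⟪x, J (adjoint T h)⟫_ℂ :=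
    fun x h => by
      rw [ContinuousLinearMap.comp_apply, ← ContinuousLinearMap.adjoint_inner_right,
        ContinuousLinearMap.adjoint_inner_left]
      rfl
  constructor
  · intro hl x h
    rw [← e1, ← e2, show _ = _ from hl]
  · intro hl
    ext x
    exact ext_inner_right ℂ fun h => (e1 x h).trans ((hl x h).trans (e2 x h).symm)

variable {S : K →L[ℂ] K} {L : Submodule ℂ K} {V : L →L[ℂ] L} {G : Lᗮ →L[ℂ] L}
  {Q : Lᗮ →L[ℂ] Lᗮ}

theorem HasBlockForm.isLifting_embedInto [CompleteSpace L] (hb : HasBlockForm S L V G Q)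
    {J : H →ₗᵢ[ℂ] K} (hL : L ≤ (LinearMap.range J.toLinearMap)ᗮ) {T : H →L[ℂ] H}
    (hl : IsLifting J S T) : IsLifting (embedInto J hL) Q T := by
  rw [isLifting_iff_inner] at hl ⊢
  intro m h
  have h1 := hl m h
  have h2 : ⟪((G m : L) : K), J h⟫_ℂ = 0 :=
    Submodule.inner_left_of_mem_orthogonal (LinearMap.mem_range_self _ h) (hL (G m).2)
  rw [hb.apply_right, inner_add_left, h2, zero_add] at h1
  exact h1

theorem HasBlockForm.adjoint_apply_right [CompleteSpace L] (hb : HasBlockForm S L V G Q)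
    (m : Lᗮ) : adjoint S m = (adjoint Q m : Lᗮ) := by
  refine ext_inner_right ℂ fun x => ?_
  obtain ⟨l, hl, y, hy, rfl⟩ := L.exists_add_mem_mem_orthogonal x
  lift l to L using hl
  lift y to Lᗮ using hy
  have e1 : ⟪(adjoint Q m : K), (l : K)⟫_ℂ = 0 :=
    Submodule.inner_left_of_mem_orthogonal l.2 (adjoint Q m).2
  have e2 : ⟪(m : K), ((V l + G y : L) : K)⟫_ℂ = 0 :=
    Submodule.inner_left_of_mem_orthogonal (V l + G y).2 m.2
  have e3 : ⟪(m : K), (Q y : K)⟫_ℂ = ⟪(adjoint Q m : K), (y : K)⟫_ℂ :=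
    (ContinuousLinearMap.adjoint_inner_left Q y m).symm
  rw [ContinuousLinearMap.adjoint_inner_left, hb l y, inner_add_right, inner_add_right, e1, e2, e3]

theorem HasBlockForm.map_ker_adjoint_le [CompleteSpace L] (hb : HasBlockForm S L V G Q) :
    (adjoint Q).ker.map Lᗮ.subtype ≤ (adjoint S).ker := by
  rintro _ ⟨m, hm, rfl⟩
  have hm' : adjoint Q m = 0 := hm
  have := hb.adjoint_apply_right m
  rw [hm'] at this
  exact this

theorem HasBlockForm.quasiIsometry_iff [CompleteSpace L] (hb : HasBlockForm S L V G Q)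
    (hS : QuasiIsometry S) (hV : Isometry V) (hG : (adjoint V).ker = G.range.topologicalClosure) :
    QuasiIsometry Q ↔ Q.range ≤ G.ker := by
  have hn : ∀ l, ‖V l‖ = ‖l‖ := (AddMonoidHomClass.isometry_iff_norm V).1 hV
  -- Expand `‖S S m‖ = ‖S m‖`: the `L`-component of `S S m` is `V G m + G Q m`, an orthogonal sum
  -- because `R(G) ⊆ N(V*)`, and `‖V G m‖ = ‖G m‖` cancels.
  have key : ∀ m, ‖G (Q m)‖ ^ 2 + ‖Q (Q m)‖ ^ 2 = ‖Q m‖ ^ 2 := by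
    intro m
    have h1 := (quasiIsometry_iff_norm S).1 hS m
    have h0 : adjoint V (G (Q m)) = 0 := by
      have : G (Q m) ∈ (adjoint V).ker :=
        hG ▸ Submodule.le_topologicalClosure _ (LinearMap.mem_range_self _ _)
      exact this
    have h2 : ⟪V (G m), G (Q m)⟫_ℂ = 0 := by
      rw [← ContinuousLinearMap.adjoint_inner_right, h0, inner_zero_right]
    have h3 := norm_add_sq_eq_norm_sq_add_norm_sq_of_inner_eq_zero _ _ h2
    have h4 := norm_add_sq_eq_norm_sq_add_norm_sq_of_inner_eq_zero (𝕜 := ℂ)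
      ((V (G m) + G (Q m) : L) : K) ((Q (Q m) : Lᗮ) : K) ((Q (Q m)).2 _ (V (G m) + G (Q m)).2)
    rw [hb.norm_sq_apply_right, hb.apply_right, hb (G m) (Q m)] at h1
    rw [hn] at h3
    simp only [Submodule.coe_norm] at h1 h3 h4 ⊢
    nlinarith
  rw [quasiIsometry_iff_norm]
  constructor
  · rintro h _ ⟨m, rfl⟩
    have := key m
    rw [h m, add_eq_right, sq_eq_zero_iff, norm_eq_zero] at this
    exact this
  · intro h m
    have h0 : G (Q m) = 0 := h (LinearMap.mem_range_self _ m)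
    simpa [h0] using key m

/-- An isometry on a Hilbert space has range complementary to the kernel of its adjoint. -/
theorem exists_add_of_isometry {V : H →L[ℂ] H} (hV : Isometry V) (x : H) :
    ∃ y, ∃ z, adjoint V z = 0 ∧ x = V y + z := by
  refine ⟨adjoint V x, x - V (adjoint V x), ?_, by abel⟩
  have : adjoint V (V (adjoint V x)) = adjoint V x := by
    have := (ContinuousLinearMap.norm_map_iff_adjoint_comp_self V).1
      ((AddMonoidHomClass.isometry_iff_norm V).1 hV)
    exact congrArg (fun F : H →L[ℂ] H => F (adjoint V x)) this
  rw [map_sub, this, sub_self]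

theorem HasBlockForm.range_adjoint_le_iff [CompleteSpace L] (hb : HasBlockForm S L V G Q)
    (hS : IsClosed (Set.range S)) (hV : Isometry V)
    (hG : (adjoint V).ker = G.range.topologicalClosure) :
    ((adjoint G).range ≤ (adjoint Q).ker ∧
        (adjoint Q).ker.map Lᗮ.subtype = (adjoint S).ker) ↔
      ((Q.range.map Lᗮ.subtype).map (S : K →ₗ[ℂ] K) ≤ Q.range.map Lᗮ.subtype ∧
        Q.range.map Lᗮ.subtype ≤ S.range) := by
  -- Closed range gives `R(S) = N(S*)ᗮ`.
  have hSr : ∀ x, (∀ y, adjoint S y = 0 → ⟪y, x⟫_ℂ = 0) → ∃ z, S z = x := by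
    intro x hx
    have hc : IsClosed (S.range : Set K) := hS
    have hx' : x ∈ S.rangeᗮᗮ := fun y hy => hx y (S.orthogonal_range.le hy)
    rw [Submodule.orthogonal_orthogonal_eq_closure, hc.submodule_topologicalClosure_eq] at hx'
    exact hx'
  constructor
  · rintro ⟨h1, h2⟩
    have hGQ : ∀ m, G (Q m) = 0 := fun m => by
      refine ext_inner_left ℂ fun l => ?_
      have : adjoint Q (adjoint G l) = 0 := h1 (LinearMap.mem_range_self _ l)
      rw [← ContinuousLinearMap.adjoint_inner_left, ← ContinuousLinearMap.adjoint_inner_left, this,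
        inner_zero_left, inner_zero_right]
    constructor
    · rintro _ ⟨_, ⟨_, ⟨m, rfl⟩, rfl⟩, rfl⟩
      refine ⟨Q (Q m), ⟨Q m, rfl⟩, ?_⟩
      have := hb.apply_right (Q m)
      rw [hGQ] at this
      simpa using this.symm
    · rintro _ ⟨_, ⟨m, rfl⟩, rfl⟩
      refine hSr _ fun y hy => ?_
      have hy' : y ∈ (adjoint Q).ker.map Lᗮ.subtype := h2 ▸ hy
      obtain ⟨k, hk, rfl⟩ := hy'
      have hk' : adjoint Q k = 0 := hk
      have := ContinuousLinearMap.adjoint_inner_left Q m k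
      rw [hk', inner_zero_left] at this
      exact this.symm
  · rintro ⟨h1, h2⟩
    have hGQ : ∀ m, G (Q m) = 0 := fun m => by
      obtain ⟨k, -, hk⟩ := h1 ⟨_, ⟨Q m, ⟨m, rfl⟩, rfl⟩, rfl⟩
      have hk' : (k : K) = (G (Q m) : L) + (Q (Q m) : Lᗮ) := hk.trans (hb.apply_right (Q m))
      -- `S Q m` lies in `R(Q) ⊆ Lᗮ`, so its `L`-component `G Q m` must vanish.
      have h3 : ((G (Q m) : L) : K) ∈ Lᗮ := by
        rw [← sub_eq_iff_eq_add] at hk'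
        rw [← hk']
        exact sub_mem k.2 (Q (Q m)).2
      have := (Submodule.disjoint_def.1 L.orthogonal_disjoint) _ (G (Q m)).2 h3
      exact_mod_cast this
    refine ⟨?_, le_antisymm hb.map_ker_adjoint_le fun y hy => ?_⟩
    · rintro _ ⟨l, rfl⟩
      change adjoint Q (adjoint G l) = 0
      refine ext_inner_right ℂ fun m => ?_
      rw [ContinuousLinearMap.adjoint_inner_left, ContinuousLinearMap.adjoint_inner_left, hGQ,
        inner_zero_left, inner_zero_right]
    · have hSR : IsClosed ((S.range.comap L.subtype : Submodule ℂ L) : Set L) :=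
        hS.preimage continuous_subtype_val
      -- `G m = S m - Q m` is in `R(S)` because `R(Q)` is; closedness of `R(S)` extends this to the
      -- closure, which is `N(V*)`.
      have hGR : G.range.topologicalClosure ≤ S.range.comap L.subtype := by
        refine Submodule.topologicalClosure_minimal _ ?_ hSR
        rintro _ ⟨m, rfl⟩
        obtain ⟨z, hz⟩ := h2 ⟨Q m, ⟨m, rfl⟩, rfl⟩
        refine ⟨m - z, ?_⟩
        have hz' : S z = Q m := hz
        change S (m - z) = G m
        rw [map_sub, hz', hb.apply_right, add_sub_cancel_right]
      -- `L = V L + N(V*)` lies in `R(S)`, so `N(S*)` is orthogonal to `L`.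
      have hyL : y ∈ Lᗮ := by
        intro l hl
        obtain ⟨k, z, hz, hl'⟩ := exists_add_of_isometry hV ⟨l, hl⟩
        obtain ⟨w, hw⟩ := hGR (hG.le hz)
        have hw' : S w = z := hw
        have : l = S (k + w) := by
          rw [map_add, hw', hb.apply_left]
          exact congrArg Subtype.val hl'
        have hy' : adjoint S y = 0 := hy
        rw [this, ← ContinuousLinearMap.adjoint_inner_right, hy', inner_zero_right]
      refine ⟨⟨y, hyL⟩, ?_, rfl⟩
      have := hb.adjoint_apply_right ⟨y, hyL⟩
      have hy' : adjoint S y = 0 := hy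
      rw [show ((⟨y, hyL⟩ : Lᗮ) : K) = y from rfl, hy'] at this
      exact Subtype.ext this.symm

end Liftings

/-! ### Vectors and operators on an orthogonal sum. -/

section OrthogonalSum

variable {A : Type*} [NormedAddCommGroup A] [InnerProductSpace ℂ A]
  {B : Type*} [NormedAddCommGroup B] [InnerProductSpace ℂ B]
  {K : Type*} [NormedAddCommGroup K] [InnerProductSpace ℂ K]
  {i : A →ₗᵢ[ℂ] K} {j : B →ₗᵢ[ℂ] K}

theorem inner_add_add (h : ∀ a b, ⟪i a, j b⟫_ℂ = 0) (a a' : A) (b b' : B) :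
    ⟪i a + j b, i a' + j b'⟫_ℂ = ⟪a, a'⟫_ℂ + ⟪b, b'⟫_ℂ := by
  have h' : ⟪j b, i a'⟫_ℂ = 0 := inner_eq_zero_symm.1 (h a' b)
  rw [inner_add_left, inner_add_right, inner_add_right, h, h', i.inner_map_map, j.inner_map_map,
    add_zero, zero_add]

theorem norm_sq_add (h : ∀ a b, ⟪i a, j b⟫_ℂ = 0) (a : A) (b : B) :
    ‖i a + j b‖ ^ 2 = ‖a‖ ^ 2 + ‖b‖ ^ 2 := by
  have := norm_add_sq_eq_norm_sq_add_norm_sq_of_inner_eq_zero _ _ (h a b)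
  rw [i.norm_map, j.norm_map] at this
  simpa [pow_two] using this

theorem exists_copair [CompleteSpace A] [CompleteSpace B] [CompleteSpace K]
    (h : ∀ a b, ⟪i a, j b⟫_ℂ = 0) {E : Type*} [NormedAddCommGroup E] [InnerProductSpace ℂ E]
    (F : A →L[ℂ] E) (G : B →L[ℂ] E) :
    ∃ W : K →L[ℂ] E, ∀ a b, W (i a + j b) = F a + G b := by
  refine ⟨F ∘L adjoint i.toContinuousLinearMap + G ∘L adjoint j.toContinuousLinearMap,
    fun a b => ?_⟩
  have h1 : adjoint i.toContinuousLinearMap (i a + j b) = a := ext_inner_right ℂ fun x => by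
    rw [ContinuousLinearMap.adjoint_inner_left]
    have e := inner_add_add h a x b 0
    rwa [map_zero, add_zero, inner_zero_right, add_zero] at e
  have h2 : adjoint j.toContinuousLinearMap (i a + j b) = b := ext_inner_right ℂ fun x => by
    rw [ContinuousLinearMap.adjoint_inner_left]
    have e := inner_add_add h a 0 b x
    rwa [map_zero, zero_add, inner_zero_right, zero_add] at e
  simp only [add_apply, ContinuousLinearMap.comp_apply, h1, h2]

end OrthogonalSum

/-! ### Construction of the liftings in (i). -/

/-- A contraction has an isometric lifting, on a nonzero space. -/
theorem exists_isometric_lifting {H : Type u} [NormedAddCommGroup H] [InnerProductSpace ℂ H]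
    [CompleteSpace H] {C : H →L[ℂ] H} (hC : ‖C‖ ≤ 1) :
    ∃ (R : Type u) (_ : NormedAddCommGroup R) (_ : InnerProductSpace ℂ R) (_ : CompleteSpace R)
      (U : R →L[ℂ] R) (ι : H →ₗᵢ[ℂ] R), Nontrivial R ∧ (∀ r, ‖U r‖ = ‖r‖) ∧
      ∀ h, adjoint U (ι h) = ι (adjoint C h) := by
  obtain ⟨D, hD, -⟩ := exists_defect hC
  -- The extra one-dimensional summand keeps `R` nonzero even when `H` is zero.
  obtain ⟨N, _, _, _, i, k, -, -⟩ := exists_orthogonal_sum H (EuclideanSpace ℂ PUnit.{u + 1})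
  obtain ⟨E, _, _, _, σ, δ, hσ, -⟩ := exists_shift N
  obtain ⟨R, _, _, _, p, q, hpq, hR⟩ := exists_orthogonal_sum H E
  -- Schäffer form: `U (h, x) = (C h, σ x + δ D h)`; the defect `D` restores the norm lost by `C`.
  obtain ⟨U, hU⟩ := exists_copair hpq
    (p.toContinuousLinearMap ∘L C +
      q.toContinuousLinearMap ∘L δ.toContinuousLinearMap ∘L i.toContinuousLinearMap ∘L D)
    (q.toContinuousLinearMap ∘L σ.toContinuousLinearMap)
  have hU' : ∀ h x, U (p h + q x) = p (C h) + q (σ x + δ (i (D h))) := fun h x => by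
    rw [hU, map_add q]
    exact (add_assoc _ _ _).trans (congrArg _ (add_comm _ _))
  refine ⟨R, inferInstance, inferInstance, inferInstance, U, p,
    (q.injective.comp (δ.injective.comp k.injective)).nontrivial, fun r => ?_, fun h => ?_⟩
  · obtain ⟨h, x, rfl⟩ := hR r
    rw [← sq_eq_sq₀ (norm_nonneg _) (norm_nonneg _), hU', norm_sq_add hpq, norm_sq_add hpq,
      norm_sq_add hσ, i.norm_map, ← hD h]
    ring
  · refine ext_inner_right ℂ fun r => ?_
    obtain ⟨h', x, rfl⟩ := hR r
    have e1 := inner_add_add hpq h (C h') 0 (σ x + δ (i (D h')))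
    have e2 := inner_add_add hpq (adjoint C h) h' 0 x
    rw [map_zero, add_zero, inner_zero_left, add_zero] at e1 e2
    rw [ContinuousLinearMap.adjoint_inner_left, hU', e1, e2,
      ContinuousLinearMap.adjoint_inner_left]

/-- An operator similar to a contraction has a quasi-isometric lifting `A` together with an
operator `B` onto a nonzero space whose kernel is the closure of the range of `A`, and such that
`A` and `B` are jointly bounded below. -/
theorem exists_quasiIsometric_lifting {H : Type u} [NormedAddCommGroup H] [InnerProductSpace ℂ H]
    [CompleteSpace H] {T : H →L[ℂ] H} (hT : SimilarToContraction T) :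
    ∃ (M : Type u) (_ : NormedAddCommGroup M) (_ : InnerProductSpace ℂ M) (_ : CompleteSpace M)
      (N : Type u) (_ : NormedAddCommGroup N) (_ : InnerProductSpace ℂ N) (_ : CompleteSpace N)
      (J : H →ₗᵢ[ℂ] M) (A : M →L[ℂ] M) (B : M →L[ℂ] N), Nontrivial N ∧ IsLifting J A T ∧
      QuasiIsometry A ∧ Function.Surjective B ∧ (∀ y, B (A y) = 0) ∧
      (∀ y, B y = 0 → y ∈ closure (Set.range A)) ∧
      ∃ c : ℝ, 0 < c ∧ ∀ y, c * ‖y‖ ^ 2 ≤ ‖A y‖ ^ 2 + ‖B y‖ ^ 2 := by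
  obtain ⟨C, hC, X, hX⟩ := hT
  obtain ⟨R, _, _, _, U, ι, hRn, hU, hUι⟩ := exists_isometric_lifting hC
  let Y : H →L[ℂ] H := adjoint (X.symm : H →L[ℂ] H)
  let Z : H →L[ℂ] H := adjoint (X : H →L[ℂ] H)
  have hZY : ∀ h, Z (Y h) = h := fun h => by
    refine ext_inner_right ℂ fun x => ?_
    simp [Z, Y, ContinuousLinearMap.adjoint_inner_left]
  have hYZ : ∀ h, Y (Z h) = h := fun h => by
    refine ext_inner_right ℂ fun x => ?_
    simp [Z, Y, ContinuousLinearMap.adjoint_inner_left]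
  have hX' : ∀ x, X (T x) = C (X x) := fun x => congrArg (fun F : H →L[ℂ] H => F x) hX
  have hYT : ∀ h, Y (adjoint T h) = adjoint C (Y h) := fun h => by
    refine ext_inner_right ℂ fun x => ?_
    have : T (X.symm x) = X.symm (C x) := by
      rw [← X.apply_symm_apply x, ← hX', X.symm_apply_apply, X.symm_apply_apply]
    simp [Y, ContinuousLinearMap.adjoint_inner_left, this]
  -- The factor `Y` turns `T*` into `C*`, hence `U* a = a T*`. Scaling by `ε` makes `a` a strict
  -- contraction, so its defect operator `b` is invertible.
  let a₀ : H →L[ℂ] R := ι.toContinuousLinearMap ∘L Y ∘L adjoint T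
  let ε : ℝ := (‖a₀‖ + 1)⁻¹
  have hε : 0 < ε := by positivity
  have hε' : (ε : ℂ) ≠ 0 := by exact_mod_cast hε.ne'
  let a : H →L[ℂ] R := (ε : ℂ) • a₀
  have ha : ∀ h, a h = ι ((ε : ℂ) • Y (adjoint T h)) := fun h => (map_smul ι _ _).symm
  have ha1 : ‖a‖ < 1 := by
    rw [norm_smul, Complex.norm_real, Real.norm_of_nonneg hε.le, inv_mul_lt_one₀ (by positivity)]
    linarith
  obtain ⟨b, hab, hb⟩ := exists_defect ha1.le
  have hbi : ∀ h, b h = 0 → h = 0 := fun h hh => by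
    obtain ⟨b', rfl⟩ := hb ha1
    have : (↑b'⁻¹ : H →L[ℂ] H) ((b' : H →L[ℂ] H) h) = h := by
      rw [← mul_apply_eq_comp, Units.inv_mul]; rfl
    rw [← this, hh, map_zero]
  let ιs : R →L[ℂ] H := adjoint ι.toContinuousLinearMap
  have hιs : ∀ h, ιs (ι h) = h := fun h => ext_inner_right ℂ fun x => by
    rw [ContinuousLinearMap.adjoint_inner_left]
    exact ι.inner_map_map h x
  -- On `ι H`, undo `ε Y` and apply `b`, which sends `a h` to `ι b T* h`; on the complement, act as
  -- the identity. Both pieces are injective with orthogonal ranges.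
  let F : R →L[ℂ] R :=
    ι.toContinuousLinearMap ∘L b ∘L ((ε : ℂ)⁻¹ • Z) ∘L ιs + (1 - ι.toContinuousLinearMap ∘L ιs)
  have hF : ∀ r, F r = ι (b ((ε : ℂ)⁻¹ • Z (ιs r))) + (r - ι (ιs r)) := fun _ => rfl
  have hFa : ∀ h, F (a h) = ι (b (adjoint T h)) := fun h => by
    rw [hF, ha, hιs, sub_self, add_zero, map_smul Z, hZY, inv_smul_smul₀ hε']
  have hFi : ∀ r, F r = 0 → r = 0 := fun r hr => by
    rw [hF] at hr
    have h1 : ιs r = 0 := by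
      have := congrArg ιs hr
      rw [map_add, map_sub, hιs, hιs, sub_self, add_zero, map_zero] at this
      have := (smul_eq_zero.1 (hbi _ this)).resolve_left (inv_ne_zero hε')
      rw [← hYZ (ιs r), this, map_zero]
    simpa [h1] using hr
  -- Injectivity of `F` is density of the range of its adjoint.
  have hEd : ∀ r, r ∈ closure (Set.range (adjoint F)) := fun r => by
    have h1 : (adjoint F).range.topologicalClosure = ⊤ := by
      rw [Submodule.topologicalClosure_eq_top_iff, ContinuousLinearMap.orthogonal_range,
        ContinuousLinearMap.adjoint_adjoint, Submodule.eq_bot_iff]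
      exact hFi
    exact h1.ge (Submodule.mem_top (x := r))
  obtain ⟨M, _, _, _, i, j, hij, hM⟩ := exists_orthogonal_sum R R
  obtain ⟨A, hA⟩ := exists_copair hij (i.toContinuousLinearMap ∘L U)
    (i.toContinuousLinearMap ∘L adjoint F)
  have hA' : ∀ r n, A (i r + j n) = i (U r + adjoint F n) := fun r n => by
    rw [hA, map_add i]; rfl
  obtain ⟨B, hB⟩ := exists_copair hij (0 : R →L[ℂ] R) (1 : R →L[ℂ] R)
  have hB' : ∀ r n, B (i r + j n) = n := fun r n => by
    rw [hB]; simp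
  have hBi : ∀ r, B (i r) = 0 := fun r => by simpa using hB' r 0
  let J : H →ₗᵢ[ℂ] M := ⟨i.toLinearMap ∘ₗ a.toLinearMap + j.toLinearMap ∘ₗ ι.toLinearMap ∘ₗ
    b.toLinearMap, fun h => by
      rw [← sq_eq_sq₀ (norm_nonneg _) (norm_nonneg _), ← hab, ← ι.norm_map (b h)]
      exact norm_sq_add hij _ _⟩
  have hJ : ∀ h, J h = i (a h) + j (ι (b h)) := fun _ => rfl
  refine ⟨M, inferInstance, inferInstance, inferInstance, R, inferInstance, inferInstance,
    inferInstance, J, A, B, hRn, ?_, ?_, fun n => ⟨i 0 + j n, hB' 0 n⟩, fun y => ?_,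
    fun y hy => ?_, (3 + 2 * ‖adjoint F‖ ^ 2)⁻¹, by positivity, fun y => ?_⟩
  · rw [isLifting_iff_inner]
    intro y h
    obtain ⟨r, n, rfl⟩ := hM y
    have e := inner_add_add hij (U r + adjoint F n) (a h) 0 (ι (b h))
    rw [map_zero, add_zero, inner_zero_left, add_zero] at e
    have e1 : adjoint U (a h) = a (adjoint T h) := by
      rw [ha, ha, hUι, map_smul, hYT (adjoint T h)]
    rw [hA', hJ, hJ, e, inner_add_add hij, inner_add_left, ContinuousLinearMap.adjoint_inner_left,
      hFa, ← ContinuousLinearMap.adjoint_inner_right, e1]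
  · rw [quasiIsometry_iff_norm]
    intro y
    obtain ⟨r, n, rfl⟩ := hM y
    have := hA' (U r + adjoint F n) 0
    rw [map_zero, map_zero, add_zero, add_zero] at this
    rw [hA', this, i.norm_map, i.norm_map, hU]
  · obtain ⟨r, n, rfl⟩ := hM y
    rw [hA', hBi]
  · obtain ⟨r, n, rfl⟩ := hM y
    rw [hB'] at hy
    rw [hy, map_zero, add_zero]
    refine map_mem_closure i.continuous (hEd r) ?_
    rintro _ ⟨n', rfl⟩
    refine ⟨i 0 + j n', ?_⟩
    rw [hA', map_zero, zero_add]
  · obtain ⟨r, n, rfl⟩ := hM y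
    rw [hA', hB', i.norm_map, norm_sq_add hij, inv_mul_le_iff₀ (by positivity)]
    -- Squaring with `(p + q)² ≤ 2p² + 2q²` and adding `‖n‖²` leaves coefficients `2` and `2‖F*‖² +
    -- 1`, both below the chosen constant.
    have h1 : ‖r‖ ≤ ‖U r + adjoint F n‖ + ‖adjoint F‖ * ‖n‖ := by
      rw [← hU r]
      calc ‖U r‖ = ‖(U r + adjoint F n) - adjoint F n‖ := by rw [add_sub_cancel_right]
        _ ≤ _ := (norm_sub_le _ _).trans (by gcongr; exact (adjoint F).le_opNorm n)
    have h2 : ‖r‖ ^ 2 ≤ (‖U r + adjoint F n‖ + ‖adjoint F‖ * ‖n‖) ^ 2 := by gcongr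
    nlinarith [sq_nonneg (‖U r + adjoint F n‖ - ‖adjoint F‖ * ‖n‖),
      sq_nonneg (‖U r + adjoint F n‖ * ‖adjoint F‖), sq_nonneg ‖n‖,
      sq_nonneg ‖U r + adjoint F n‖]

/-- Extending a quasi-isometric lifting by a shift: the upper left corner is the shift, and the
upper right corner maps onto its wandering subspace. -/
theorem exists_block_lifting {H : Type u} [NormedAddCommGroup H] [InnerProductSpace ℂ H]
    [CompleteSpace H] {T : H →L[ℂ] H} {M : Type u} [NormedAddCommGroup M]
    [InnerProductSpace ℂ M] [CompleteSpace M] {N : Type u} [NormedAddCommGroup N]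
    [InnerProductSpace ℂ N] [CompleteSpace N] [Nontrivial N] {J₀ : H →ₗᵢ[ℂ] M} {A : M →L[ℂ] M}
    {B : M →L[ℂ] N} (hl : IsLifting J₀ A T) (hA : QuasiIsometry A) (hB : Function.Surjective B)
    (hBA : ∀ y, B (A y) = 0) (hcl : ∀ y, B y = 0 → y ∈ closure (Set.range A)) {c : ℝ} (hc : 0 < c)
    (hAB : ∀ y, c * ‖y‖ ^ 2 ≤ ‖A y‖ ^ 2 + ‖B y‖ ^ 2) :
    ∃ (K : Type u) (_ : NormedAddCommGroup K) (_ : InnerProductSpace ℂ K) (_ : CompleteSpace K)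
      (J : H →ₗᵢ[ℂ] K) (S : K →L[ℂ] K)
      (L : Submodule ℂ K) (_ : CompleteSpace L) (hL : L ≤ (LinearMap.range J.toLinearMap)ᗮ)
      (V : L →L[ℂ] L) (G : Lᗮ →L[ℂ] L) (Q : Lᗮ →L[ℂ] Lᗮ),
      IsLifting J S T ∧ QuasiIsometry S ∧ SimilarToIsometry S ∧ L ≠ ⊥ ∧
      HasBlockForm S L V G Q ∧ Isometry V ∧ (adjoint V).ker = G.range ∧
      IsLifting (embedInto J hL) Q T ∧ QuasiIsometry Q ∧ Q.range.topologicalClosure = G.ker ∧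
      (adjoint Q).ker.map Lᗮ.subtype ≤ (adjoint S).ker := by
  obtain ⟨E, _, _, _, σ, δ, hσ, hE⟩ := exists_shift N
  obtain ⟨K, _, _, _, k, j, hkj, hK⟩ := exists_orthogonal_sum M E
  have hA' := (quasiIsometry_iff_norm A).1 hA
  -- `S (y, q) = (A y, σ q + δ B y)`.
  obtain ⟨S, hS₀⟩ := exists_copair hkj
    (k.toContinuousLinearMap ∘L A + j.toContinuousLinearMap ∘L δ.toContinuousLinearMap ∘L B)
    (j.toContinuousLinearMap ∘L σ.toContinuousLinearMap)
  have hS : ∀ y q, S (k y + j q) = k (A y) + j (σ q + δ (B y)) := fun y q => by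
    rw [hS₀, map_add j]
    exact (add_assoc _ _ _).trans (congrArg _ (add_comm _ _))
  have hSj : ∀ q, S (j q) = j (σ q) := fun q => by simpa using hS 0 q
  have hSk : ∀ y, S (k y) = k (A y) + j (δ (B y)) := fun y => by simpa using hS y 0
  -- As `B A = 0`, the second application of `S` only shifts the `E`-component, preserving its norm.
  have hSq : QuasiIsometry S := by
    rw [quasiIsometry_iff_norm]
    intro x
    obtain ⟨y, q, rfl⟩ := hK x
    rw [hS, hS, hBA, map_zero, add_zero, norm_sq_add hkj, norm_sq_add hkj, hA', σ.norm_map]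
  have hSs : SimilarToIsometry S := by
    -- `‖S (y, q)‖² = ‖A y‖² + ‖B y‖² + ‖q‖²`: the `M`-part is bounded below by `c`, the `E`-part by
    -- `1`.
    refine similarToIsometry_of_quasiIsometry hSq (c := min c 1) (by positivity) fun x => ?_
    obtain ⟨y, q, rfl⟩ := hK x
    rw [hS, norm_sq_add hkj, norm_sq_add hkj, norm_sq_add hσ]
    have := hAB y
    nlinarith [min_le_left c 1, min_le_right c 1, sq_nonneg ‖y‖, sq_nonneg ‖q‖]
  let J : H →ₗᵢ[ℂ] K := k.comp J₀
  have hJ : IsLifting J S T := by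
    rw [isLifting_iff_inner] at hl ⊢
    intro x h
    obtain ⟨y, q, rfl⟩ := hK x
    have e1 := inner_add_add hkj (A y) (J₀ h) (σ q + δ (B y)) 0
    have e2 := inner_add_add hkj y (J₀ (adjoint T h)) q 0
    rw [map_zero, add_zero, inner_zero_right, add_zero] at e1 e2
    exact (congrArg (fun z => ⟪z, k (J₀ h)⟫_ℂ) (hS y q)).trans (e1.trans ((hl y h).trans e2.symm))
  let L : Submodule ℂ K := LinearMap.range j.toLinearMap
  have hLc : CompleteSpace L := (j.isometry.isUniformInducing.isComplete_range).completeSpace_coe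
  have hkL : ∀ y, k y ∈ Lᗮ := by
    rintro y _ ⟨q, rfl⟩
    exact inner_eq_zero_symm.1 (hkj y q)
  have hLk : ∀ m : Lᗮ, ∃ y, m = ⟨k y, hkL y⟩ := by
    rintro ⟨m, hm⟩
    obtain ⟨y, q, rfl⟩ := hK m
    have := hm (j q) ⟨q, rfl⟩
    have e := inner_add_add hkj 0 y q q
    rw [map_zero, zero_add, inner_zero_left, zero_add] at e
    rw [e, inner_self_eq_zero] at this
    exact ⟨y, Subtype.ext (by simp [this])⟩
  have hL : L ≤ (LinearMap.range J.toLinearMap)ᗮ := by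
    rintro _ ⟨q, rfl⟩ _ ⟨h, rfl⟩
    exact hkj (J₀ h) q
  have hjL : ∀ q, j q ∈ L := fun q => LinearMap.mem_range_self _ q
  obtain ⟨V, G, Q, hb⟩ := exists_hasBlockForm (S := S) (L := L) (by
    rintro _ ⟨q, rfl⟩
    exact ⟨σ q, (hSj q).symm⟩)
  have hV : ∀ q, V ⟨j q, hjL q⟩ = ⟨j (σ q), hjL _⟩ := fun q =>
    Subtype.ext ((hb.apply_left ⟨j q, hjL q⟩).symm.trans (hSj q))
  have hGQ : ∀ y, G ⟨k y, hkL y⟩ = ⟨j (δ (B y)), hjL _⟩ ∧ Q ⟨k y, hkL y⟩ = ⟨k (A y), hkL _⟩ := by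
    intro y
    have h1 : k (A y) + j (δ (B y)) = (G ⟨k y, hkL y⟩ : K) + Q ⟨k y, hkL y⟩ :=
      (hSk y).symm.trans (hb.apply_right ⟨k y, hkL y⟩)
    have h2 : (G ⟨k y, hkL y⟩ : K) - j (δ (B y)) = k (A y) - Q ⟨k y, hkL y⟩ := by
      rw [sub_eq_sub_iff_add_eq_add, ← h1]
    have h3 : (G ⟨k y, hkL y⟩ : K) - j (δ (B y)) = 0 := by
      refine Submodule.disjoint_def.1 L.orthogonal_disjoint _ (sub_mem (G _).2 (hjL _)) ?_
      rw [h2]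
      exact sub_mem (hkL _) (Q _).2
    exact ⟨Subtype.ext (sub_eq_zero.1 h3), Subtype.ext (sub_eq_zero.1 (h2.symm.trans h3)).symm⟩
  have hVi : Isometry V := by
    refine AddMonoidHomClass.isometry_of_norm _ ?_
    rintro ⟨_, q, rfl⟩
    exact (congrArg norm (hV q)).trans
      ((j.norm_map _).trans ((σ.norm_map q).trans (j.norm_map q).symm))
  have hδ : ∀ n, adjoint V ⟨j (δ n), hjL _⟩ = 0 := by
    refine fun n => ext_inner_right ℂ ?_
    rintro ⟨_, q, rfl⟩
    rw [ContinuousLinearMap.adjoint_inner_left, inner_zero_left]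
    refine (congrArg (fun z => ⟪(⟨j (δ n), hjL _⟩ : L), z⟫_ℂ) (hV q)).trans ?_
    exact (j.inner_map_map (δ n) (σ q)).trans (inner_eq_zero_symm.1 (hσ q n))
  refine ⟨K, inferInstance, inferInstance, inferInstance, J, S, L, hLc, hL, V, G, Q, hJ, hSq, hSs,
    ?_, hb, hVi, le_antisymm ?_ ?_, hb.isLifting_embedInto hL hJ, ?_, le_antisymm ?_ ?_,
    hb.map_ker_adjoint_le⟩
  · obtain ⟨n, hn⟩ := exists_ne (0 : N)
    intro h
    have := (Submodule.eq_bot_iff _).1 h _ (hjL (δ n))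
    rw [← map_zero j] at this
    exact hn (δ.injective ((j.injective this).trans (map_zero δ).symm))
  -- `V*` recovers the shifted part `q`, so `q = 0` and only the wandering part `δ n` remains;
  -- surjectivity of `B` puts it in `R(G)`, with no closure needed.
  · rintro ⟨_, x, rfl⟩ hz
    obtain ⟨q, n, rfl⟩ := hE x
    obtain ⟨y, rfl⟩ := hB n
    have hz' : adjoint V ⟨j (σ q + δ (B y)), hjL _⟩ = 0 := hz
    have e : (⟨j (σ q + δ (B y)), hjL _⟩ : L) = V ⟨j q, hjL q⟩ + ⟨j (δ (B y)), hjL _⟩ := by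
      rw [hV]
      exact Subtype.ext (map_add j _ _)
    have hVV : adjoint V (V ⟨j q, hjL q⟩) = ⟨j q, hjL q⟩ :=
      congrArg (fun W : L →L[ℂ] L => W ⟨j q, hjL q⟩)
        ((ContinuousLinearMap.norm_map_iff_adjoint_comp_self V).1
          ((AddMonoidHomClass.isometry_iff_norm V).1 hVi))
    rw [e, map_add, hδ, add_zero, hVV] at hz'
    refine ⟨⟨k y, hkL y⟩, (hGQ y).1.trans ?_⟩
    refine Eq.trans ?_ e.symm
    rw [hz', map_zero, zero_add]
  · rintro _ ⟨m, rfl⟩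
    obtain ⟨y, rfl⟩ := hLk m
    change adjoint V (G _) = 0
    rw [(hGQ y).1, hδ]
  · rw [quasiIsometry_iff_norm]
    intro m
    obtain ⟨y, rfl⟩ := hLk m
    rw [(hGQ y).2, (hGQ _).2]
    have := hA' y
    rwa [← k.norm_map, ← k.norm_map (A y)] at this
  · refine Submodule.topologicalClosure_minimal _ ?_ G.isClosed_ker
    rintro _ ⟨m, rfl⟩
    obtain ⟨y, rfl⟩ := hLk m
    change G (Q _) = 0
    rw [(hGQ y).2, (hGQ _).1]
    exact Subtype.ext (by simp [hBA])
  · intro m hm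
    obtain ⟨y, rfl⟩ := hLk m
    have hm' : G ⟨k y, hkL y⟩ = 0 := hm
    rw [(hGQ y).1] at hm'
    have h1 : j (δ (B y)) = 0 := congrArg Subtype.val hm'
    have h2 : B y = 0 := by
      rwa [← norm_eq_zero, j.norm_map, δ.norm_map, norm_eq_zero] at h1
    refine map_mem_closure (f := fun y => (⟨k y, hkL y⟩ : Lᗮ))
      (k.continuous.subtype_mk _) (hcl y h2) ?_
    rintro _ ⟨y', rfl⟩
    exact ⟨⟨k y', hkL y'⟩, (hGQ y').2⟩

end QuasiIsoLift

theorem theorem3p1 {H : Type u} [NormedAddCommGroup H] [InnerProductSpace ℂ H]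
    [CompleteSpace H] (T : H →L[ℂ] H) :
    -- (i)
    (QuasiIsoLift.SimilarToContraction T →
      ∃ (K : Type u) (_ : NormedAddCommGroup K) (_ : InnerProductSpace ℂ K) (_ : CompleteSpace K)
        (J : H →ₗᵢ[ℂ] K) (S : K →L[ℂ] K)
        (L : Submodule ℂ K) (_ : CompleteSpace L) (hL : L ≤ (LinearMap.range J.toLinearMap)ᗮ)
        (V : L →L[ℂ] L) (G : Lᗮ →L[ℂ] L) (Q : Lᗮ →L[ℂ] Lᗮ),
        QuasiIsoLift.IsLifting J S T ∧
        QuasiIsoLift.QuasiIsometry S ∧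
        QuasiIsoLift.SimilarToIsometry S ∧
        L ≠ ⊥ ∧
        QuasiIsoLift.HasBlockForm S L V G Q ∧
        Isometry V ∧
        (adjoint V).ker = G.range ∧
        QuasiIsoLift.IsLifting (QuasiIsoLift.embedInto J hL) Q T ∧
        QuasiIsoLift.QuasiIsometry Q ∧
        Q.range.topologicalClosure = G.ker ∧
        (adjoint Q).ker.map Lᗮ.subtype ≤ (adjoint S).ker) ∧
    -- (ii)
    (∀ (K : Type v) [NormedAddCommGroup K] [InnerProductSpace ℂ K] [CompleteSpace K]
        (J : H →ₗᵢ[ℂ] K) (S : K →L[ℂ] K)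
        (L : Submodule ℂ K) [CompleteSpace L] (hL : L ≤ (LinearMap.range J.toLinearMap)ᗮ)
        (V : L →L[ℂ] L) (G : Lᗮ →L[ℂ] L) (Q : Lᗮ →L[ℂ] Lᗮ),
        QuasiIsoLift.IsLifting J S T →
        QuasiIsoLift.QuasiIsometry S →
        QuasiIsoLift.LeftInvertible S →
        QuasiIsoLift.HasBlockForm S L V G Q →
        Isometry V →
        (adjoint V).ker = G.range.topologicalClosure →
        QuasiIsoLift.IsLifting (QuasiIsoLift.embedInto J hL) Q T ∧
        (QuasiIsoLift.QuasiIsometry Q ↔ Q.range ≤ G.ker) ∧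
        (((adjoint G).range ≤ (adjoint Q).ker ∧
            (adjoint Q).ker.map Lᗮ.subtype = (adjoint S).ker) ↔
          ((Q.range.map Lᗮ.subtype).map (S : K →ₗ[ℂ] K) ≤ Q.range.map Lᗮ.subtype ∧
            Q.range.map Lᗮ.subtype ≤ S.range))) := by
  refine ⟨fun hT => ?_, fun K _ _ _ J S L _ hL V G Q hl hq hi hb hV hG => ?_⟩
  · obtain ⟨M, _, _, _, N, _, _, _, J, A, B, _, hl, hA, hB, hBA, hcl, c, hc, hAB⟩ :=
      QuasiIsoLift.exists_quasiIsometric_lifting hT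
    exact QuasiIsoLift.exists_block_lifting hl hA hB hBA hcl hc hAB
  · exact ⟨hb.isLifting_embedInto hL hl, hb.quasiIsometry_iff hq hV hG,
      hb.range_adjoint_le_iff hi.2 hV hG⟩
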